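/- Let $r\ge 1$ be an integer. For real $x$ let $S_r(x)$ be the number of pairs $([G],[H])$ of isomorphism classes of finite abelian groups such that $G$ has order at most $x$ and rank at most $r$ (that is, $G$ can be generated by at most $r$ elements; equivalently, $G\cong\mathbb Z/n_1\mathbb Z\oplus\mathbb Z/n_1n_2\mathbb Z\oplus\cdots\oplus\mathbb Z/n_1n_2\cdots n_r\mathbb Z$ for some positive integers $n_1,\dots,n_r$) and $H$ is isomorphic to a subgroup of $G$. In other words, $S_r(x)=\sum_G\#\{\text{subgroups of } G\}/{\cong}$, where $G$ runs over the abelian groups of rank at most $r$ and order at most $x$ up to isomorphism, and isomorphic subgroups of the same $G$ are counted only once. Then there is a constant $C_r>0$, depending only on $r$, such that $$S_r(x)\sim C_r\,x\log x\qquad (x\to\infty).$$ -/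

import Mathlib

open Filter Asymptotics

/-- A finite abelian group together with one of its subgroups. -/
structure FinAbSubgroup where
  /-- the underlying set of the finite abelian group -/
  carrier : Type
  [grp : AddCommGroup carrier]
  [fin : Finite carrier]
  /-- the chosen subgroup -/
  sub : AddSubgroup carrier

attribute [instance] FinAbSubgroup.grp FinAbSubgroup.fin

/-- Two pairs `(G, H)`, `(G', H')` are identified when `G ≅ G'` and `H ≅ H'` as abstract groups:
the groups `G` are taken up to isomorphism, and isomorphic subgroups of a given group are
counted only once. -/
instance FinAbSubgroup.setoid : Setoid FinAbSubgroup where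
  r P Q := Nonempty (P.carrier ≃+ Q.carrier) ∧ Nonempty (P.sub ≃+ Q.sub)
  iseqv :=
    { refl := fun _ => ⟨⟨AddEquiv.refl _⟩, ⟨AddEquiv.refl _⟩⟩
      symm := fun ⟨⟨e⟩, ⟨f⟩⟩ => ⟨⟨e.symm⟩, ⟨f.symm⟩⟩
      trans := fun ⟨⟨e⟩, ⟨f⟩⟩ ⟨⟨e'⟩, ⟨f'⟩⟩ => ⟨⟨e.trans e'⟩, ⟨f.trans f'⟩⟩ }

/-- The subgroup classes of finite abelian groups. -/
def FinAbSubgroupClass : Type 1 := Quotient FinAbSubgroup.setoid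

/-- The set of the subgroup classes of finite abelian groups of rank (the minimal number of
generators) at most `r` and order at most `x`. -/
def subgroupClasses (r : ℕ) (x : ℝ) : Set FinAbSubgroupClass :=
  {c | ∃ P : FinAbSubgroup, AddGroup.rank P.carrier ≤ r ∧ (Nat.card P.carrier : ℝ) ≤ x ∧
    c = Quotient.mk FinAbSubgroup.setoid P}

/-- The number of subgroup classes of abelian groups of rank at most `r` and order at most `x`. -/
noncomputable def subgroupClassCount (r : ℕ) (x : ℝ) : ℕ := (subgroupClasses r x).ncard

/-! Let a(n) count the classes with G of order exactly n. Splitting G and H along coprime factors of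
n makes a multiplicative (`ncard_subgroupClassesOfCard_mul`). Also a(p) = 2, and a(n) ≤ d(n)^(2r),
with d the number of divisors, because G and H are sums of at most r cyclic groups of order dividing
n. Hence a = g * ζ * ζ with g multiplicative and zero at the primes, so that ∑ |g(n)|/n converges
(`summable_abs_div_of_isMultiplicative`). The sum of a up to x is ∑ g(n) D(x/n), where D is the
summatory function of d and D(y) ~ y log y. Dominated convergence gives the limit C = ∑ g(n)/n.
Positivity needs no Euler product: the cyclic group of order n alone gives a(n) ≥ d(n), hence C ≥ 1.
-/

section Rank

/-! ### Rank and cyclic decompositions -/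

variable {G : Type*} [AddCommGroup G] [Finite G] {r : ℕ}

theorem AddGroup.rank_le_iff_exists_surjective :
    AddGroup.rank G ≤ r ↔ ∃ φ : (Fin r → ℤ) →ₗ[ℤ] G, Function.Surjective φ := by
  classical
  constructor
  · intro h
    obtain ⟨S, hS, hS'⟩ := AddGroup.rank_spec G
    let g : Fin r → G := fun i =>
      if hi : (i : ℕ) < S.card then (S.equivFin.symm ⟨i, hi⟩ : G) else 0
    refine ⟨Fintype.linearCombination ℤ g, ?_⟩
    rw [← LinearMap.range_eq_top, Fintype.range_linearCombination, eq_top_iff]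
    have hsub : (S : Set G) ⊆ Set.range g := by
      intro s hs
      refine ⟨⟨S.equivFin ⟨s, hs⟩, (S.equivFin ⟨s, hs⟩).2.trans_le (hS.le.trans h)⟩, ?_⟩
      simp [g]
    intro x _
    have hx : x ∈ AddSubgroup.closure (S : Set G) := hS' ▸ AddSubgroup.mem_top x
    have hle : AddSubgroup.closure (S : Set G) ≤
        (Submodule.span ℤ (Set.range g)).toAddSubgroup :=
      (AddSubgroup.closure_le _).2 (hsub.trans Submodule.subset_span)
    exact hle hx
  · rintro ⟨φ, hφ⟩
    have hcl : AddSubgroup.closure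
        ((Finset.univ.image fun i : Fin r => φ (Pi.single i 1) : Finset G) : Set G) = ⊤ := by
      rw [eq_top_iff]
      intro x _
      obtain ⟨y, rfl⟩ := hφ x
      rw [pi_eq_sum_univ' y, map_sum]
      refine sum_mem fun i _ => ?_
      have : (y i • fun j => if i = j then (1 : ℤ) else 0) = y i • Pi.single i 1 := by
        ext j; simp [Pi.single_apply, eq_comm]
      rw [map_smul]
      refine AddSubgroup.zsmul_mem _ (AddSubgroup.subset_closure ?_) _
      simp only [Finset.coe_image, Finset.coe_univ, Set.image_univ, Set.mem_range]
      exact ⟨i, by congr 1⟩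
    refine (AddGroup.rank_le hcl).trans (Finset.card_image_le.trans ?_)
    simp

/-- The preimage of `H` in a free group ℤ^k mapping onto `G` is itself free of rank at most k. -/
theorem AddSubgroup.rank_le_rank (H : AddSubgroup G) : AddGroup.rank H ≤ AddGroup.rank G := by
  obtain ⟨φ, hφ⟩ := AddGroup.rank_le_iff_exists_surjective.1 (le_refl (AddGroup.rank G))
  let M : Submodule ℤ (Fin (AddGroup.rank G) → ℤ) := (AddSubgroup.toIntSubmodule H).comap φ
  have hM : Module.finrank ℤ M ≤ AddGroup.rank G := by
    simpa using Submodule.finrank_le M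
  refine le_trans (AddGroup.rank_le_iff_exists_surjective.2 ?_) hM
  let ψ : M →ₗ[ℤ] AddSubgroup.toIntSubmodule H :=
    (φ.comp M.subtype).codRestrict _ fun x => x.2
  have hψ : Function.Surjective ψ := by
    rintro ⟨h, hh⟩
    obtain ⟨y, rfl⟩ := hφ h
    exact ⟨⟨y, hh⟩, rfl⟩
  exact ⟨ψ.comp (Module.finBasis ℤ M).equivFun.symm.toLinearMap,
    hψ.comp (LinearEquiv.surjective _)⟩

/-- Smith normal form of the finite-index kernel of ℤ^r → `G`; trivial factors keep the index set
equal to `Fin r`. -/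
theorem AddGroup.exists_addEquiv_pi_zmod_of_rank_le (h : AddGroup.rank G ≤ r) :
    ∃ a : Fin r → ℕ, Nonempty (G ≃+ ∀ i, ZMod (a i)) := by
  obtain ⟨φ, hφ⟩ := AddGroup.rank_le_iff_exists_surjective.1 h
  let e := φ.quotKerEquivOfSurjective hφ
  have : Finite ((Fin r → ℤ) ⧸ LinearMap.ker φ) := Finite.of_equiv G e.symm.toEquiv
  exact ⟨_, ⟨e.symm.toAddEquiv.trans (Submodule.quotientEquivPiZMod _ (Pi.basisFun ℤ (Fin r))
    ((Submodule.finiteQuotient_iff _).1 this))⟩⟩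

theorem AddGroup.exists_addEquiv_pi_zmod_divisors {n : ℕ} (hn : n ≠ 0)
    (h : AddGroup.rank G ≤ r) (hd : Nat.card G ∣ n) :
    ∃ a : Fin r → n.divisors, Nonempty (G ≃+ ∀ i, ZMod (a i : ℕ)) := by
  obtain ⟨a, ⟨e⟩⟩ := AddGroup.exists_addEquiv_pi_zmod_of_rank_le h
  have hc : Nat.card G = ∏ i, a i := by
    rw [Nat.card_congr e.toEquiv, Nat.card_pi]; simp
  exact ⟨fun i => ⟨a i, Nat.mem_divisors.2
    ⟨((Finset.dvd_prod_of_mem a (Finset.mem_univ i)).trans hc.symm.dvd).trans hd, hn⟩⟩, ⟨e⟩⟩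

end Rank

/-! ### Counting classes by the order of the group -/

/-- The subgroup classes of abelian groups of rank at most `r` and order exactly `n`. -/
def subgroupClassesOfCard (r n : ℕ) : Set FinAbSubgroupClass :=
  {c | ∃ P : FinAbSubgroup, AddGroup.rank P.carrier ≤ r ∧ Nat.card P.carrier = n ∧
    c = Quotient.mk FinAbSubgroup.setoid P}

theorem FinAbSubgroup.mk_eq_mk {P Q : FinAbSubgroup} :
    Quotient.mk FinAbSubgroup.setoid P = Quotient.mk FinAbSubgroup.setoid Q ↔
      Nonempty (P.carrier ≃+ Q.carrier) ∧ Nonempty (P.sub ≃+ Q.sub) :=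
  Quotient.eq

/-- The orders of cyclic factors determine a group, so any choice of decompositions of `G` and `H`
is injective on classes; no canonical form is needed. -/
theorem exists_injOn_subgroupClassesOfCard (r : ℕ) {n : ℕ} (hn : n ≠ 0) :
    ∃ f : FinAbSubgroupClass → (Fin r → n.divisors) × (Fin r → n.divisors),
      Set.InjOn f (subgroupClassesOfCard r n) := by
  classical
  have key : ∀ c, ∃ ab : (Fin r → n.divisors) × (Fin r → n.divisors),
      c ∈ subgroupClassesOfCard r n → ∃ P : FinAbSubgroup,
        c = Quotient.mk FinAbSubgroup.setoid P ∧
        Nonempty (P.carrier ≃+ ∀ i, ZMod (ab.1 i : ℕ)) ∧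
        Nonempty (P.sub ≃+ ∀ i, ZMod (ab.2 i : ℕ)) := by
    intro c
    by_cases hc : c ∈ subgroupClassesOfCard r n
    · obtain ⟨P, hr, hcard, rfl⟩ := hc
      obtain ⟨a, ha⟩ := AddGroup.exists_addEquiv_pi_zmod_divisors hn hr hcard.dvd
      obtain ⟨b, hb⟩ := AddGroup.exists_addEquiv_pi_zmod_divisors hn
        (P.sub.rank_le_rank.trans hr) (P.sub.card_addSubgroup_dvd_card.trans hcard.dvd)
      exact ⟨(a, b), fun _ => ⟨P, rfl, ha, hb⟩⟩
    · exact ⟨(fun _ => ⟨1, by simp [hn]⟩, fun _ => ⟨1, by simp [hn]⟩), fun h => absurd h hc⟩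
  choose f hf using key
  refine ⟨f, fun c hc c' hc' h => ?_⟩
  obtain ⟨P, rfl, ⟨e⟩, ⟨e'⟩⟩ := hf c hc
  obtain ⟨Q, rfl, ⟨u⟩, ⟨u'⟩⟩ := hf c' hc'
  rw [← h] at u u'
  exact FinAbSubgroup.mk_eq_mk.2 ⟨⟨e.trans u.symm⟩, ⟨e'.trans u'.symm⟩⟩

theorem subgroupClassesOfCard_zero (r : ℕ) : subgroupClassesOfCard r 0 = ∅ := by
  ext c
  simp only [subgroupClassesOfCard, Set.mem_ofPred_eq, Set.mem_empty_iff_false, iff_false]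
  rintro ⟨P, -, h, -⟩
  exact Nat.card_pos.ne' h

theorem finite_subgroupClassesOfCard (r n : ℕ) : (subgroupClassesOfCard r n).Finite := by
  rcases eq_or_ne n 0 with rfl | hn
  · simp [subgroupClassesOfCard_zero]
  · obtain ⟨f, hf⟩ := exists_injOn_subgroupClassesOfCard r hn
    exact Set.Finite.of_finite_image (Set.toFinite _) hf

theorem ncard_subgroupClassesOfCard_le (r : ℕ) {n : ℕ} (hn : n ≠ 0) :
    (subgroupClassesOfCard r n).ncard ≤ n.divisors.card ^ (2 * r) := by
  obtain ⟨f, hf⟩ := exists_injOn_subgroupClassesOfCard r hn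
  rw [← hf.ncard_image]
  refine (Set.ncard_le_ncard (Set.subset_univ _) (Set.toFinite _)).trans ?_
  rw [Set.ncard_univ, Nat.card_eq_fintype_card]
  simp [two_mul, pow_add]

theorem subgroupClassCount_eq_sum (r : ℕ) {x : ℝ} (hx : 0 ≤ x) :
    subgroupClassCount r x = ∑ n ∈ Finset.Ioc 0 ⌊x⌋₊, (subgroupClassesOfCard r n).ncard := by
  have hU : subgroupClasses r x = ⋃ n ∈ (Finset.Ioc 0 ⌊x⌋₊ : Set ℕ),
      subgroupClassesOfCard r n := by
    ext c
    simp only [subgroupClasses, subgroupClassesOfCard, Set.mem_ofPred_eq, Set.mem_iUnion,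
      Finset.mem_coe, Finset.mem_Ioc, exists_prop]
    constructor
    · rintro ⟨P, hr, hc, rfl⟩
      exact ⟨_, ⟨Nat.card_pos, Nat.le_floor hc⟩, P, hr, rfl, rfl⟩
    · rintro ⟨n, ⟨-, hn⟩, P, hr, rfl, rfl⟩
      exact ⟨P, hr, (Nat.le_floor_iff hx).1 hn, rfl⟩
  rw [subgroupClassCount, hU, Set.Finite.ncard_biUnion (Finset.finite_toSet _)
    (fun n _ => finite_subgroupClassesOfCard r n), finsum_mem_coe_finset]
  intro m _ n _ hmn
  refine Set.disjoint_left.2 ?_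
  rintro _ ⟨P, -, hP, rfl⟩ ⟨Q, -, hQ, h⟩
  obtain ⟨⟨e⟩, -⟩ := FinAbSubgroup.mk_eq_mk.1 h
  exact hmn (hP.symm.trans ((Nat.card_congr e.toEquiv).trans hQ))

/-! ### The divisor problem and dominated convergence -/

open ArithmeticFunction ArithmeticFunction.zeta ArithmeticFunction.Moebius in
theorem sum_Ioc_zeta_mul_zeta_eq_sum (N : ℕ) :
    ∑ n ∈ Finset.Ioc 0 N, ((ζ : ArithmeticFunction ℝ) * (ζ : ArithmeticFunction ℝ)) n =
      ∑ n ∈ Finset.Ioc 0 N, ((N / n : ℕ) : ℝ) := by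
  rw [sum_Ioc_mul_zeta_eq_sum]
  refine Finset.sum_congr rfl fun n hn => ?_
  have : n ≠ 0 := (Finset.mem_Ioc.1 hn).1.ne'
  simp [natCoe_apply, zeta_apply, this]

/-- The number of pairs of positive integers with product at most `y`. -/
noncomputable def divisorSummatory (y : ℝ) : ℝ :=
  ∑ n ∈ Finset.Ioc 0 ⌊y⌋₊, ((⌊y⌋₊ / n : ℕ) : ℝ)

theorem divisorSummatory_nonneg (y : ℝ) : 0 ≤ divisorSummatory y := by
  unfold divisorSummatory; positivity

theorem divisorSummatory_of_lt_one {y : ℝ} (hy : y < 1) : divisorSummatory y = 0 := by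
  simp [divisorSummatory, Nat.floor_eq_zero.2 hy]

theorem sum_Ioc_floor_div (y : ℝ) :
    ∑ n ∈ Finset.Ioc 0 ⌊y⌋₊, y / n = y * harmonic ⌊y⌋₊ := by
  rw [harmonic_eq_sum_Icc, Rat.cast_sum, Finset.mul_sum]
  refine Finset.sum_congr rfl fun n _ => ?_
  simp [div_eq_mul_inv]

theorem divisorSummatory_le {y : ℝ} (hy : 1 ≤ y) :
    divisorSummatory y ≤ y * (1 + Real.log y) := by
  refine le_trans ?_ (mul_le_mul_of_nonneg_left (harmonic_floor_le_one_add_log y hy)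
    (by linarith))
  rw [← sum_Ioc_floor_div]
  refine Finset.sum_le_sum fun n _ => ?_
  rw [← Nat.floor_div_natCast]
  exact Nat.floor_le (by positivity)

theorem le_divisorSummatory {y : ℝ} (hy : 1 ≤ y) :
    y * (Real.log y - 1) ≤ divisorSummatory y := by
  have h0 : 0 ≤ y := by linarith
  have h1 : y * Real.log y ≤ ∑ n ∈ Finset.Ioc 0 ⌊y⌋₊, y / n := by
    rw [sum_Ioc_floor_div]
    exact mul_le_mul_of_nonneg_left (log_le_harmonic_floor y h0) h0
  have h2 : ∑ n ∈ Finset.Ioc 0 ⌊y⌋₊, (y / n - 1) ≤ divisorSummatory y := by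
    refine Finset.sum_le_sum fun n _ => ?_
    rw [← Nat.floor_div_natCast]
    linarith [Nat.lt_floor_add_one (y / n)]
  rw [Finset.sum_sub_distrib] at h2
  have h3 : (∑ n ∈ Finset.Ioc 0 ⌊y⌋₊, (1 : ℝ)) ≤ y := by
    simpa using Nat.floor_le h0
  linarith

theorem tendsto_divisorSummatory_div (d : ℕ) (hd : d ≠ 0) :
    Tendsto (fun x : ℝ => divisorSummatory (x / d) / (x * Real.log x)) atTop
      (nhds (1 / d)) := by
  have hd' : (0 : ℝ) < d := by positivity
  have hd1 : (1 : ℝ) ≤ d := by exact_mod_cast Nat.one_le_iff_ne_zero.2 hd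
  have hlim : ∀ c : ℝ, Tendsto (fun x : ℝ => 1 / d * (1 + c / Real.log x)) atTop
      (nhds (1 / d)) := by
    intro c
    have := (((tendsto_const_nhds (x := c)).div_atTop Real.tendsto_log_atTop).const_add 1).const_mul
      (1 / (d : ℝ))
    simpa using this
  refine tendsto_of_tendsto_of_tendsto_of_le_of_le' (hlim (-(Real.log d + 1)))
    (hlim (1 - Real.log d)) ?_ ?_
  all_goals
    filter_upwards [eventually_ge_atTop (d : ℝ), eventually_gt_atTop 1] with x hx hx1
    have hl : 0 < Real.log x := Real.log_pos hx1
    have hx0 : 0 < x := by linarith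
    have h1 : 1 ≤ x / d := (one_le_div hd').2 hx
    have hlog : Real.log (x / d) = Real.log x - Real.log d :=
      Real.log_div hx0.ne' hd'.ne'
  · rw [le_div_iff₀ (by positivity)]
    refine le_trans (le_of_eq ?_) (le_divisorSummatory h1)
    rw [hlog]; field_simp; ring
  · rw [div_le_iff₀ (by positivity)]
    refine (divisorSummatory_le h1).trans (le_of_eq ?_)
    rw [hlog]; field_simp; ring

/-- Uniformity in `d` supplies the dominating series for the passage to the limit. -/
theorem divisorSummatory_div_le {d : ℕ} (hd : d ≠ 0) {x : ℝ} (hx : Real.exp 1 ≤ x) :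
    divisorSummatory (x / d) / (x * Real.log x) ≤ 2 / d := by
  have hd' : (0 : ℝ) < d := by positivity
  have hd1 : (1 : ℝ) ≤ d := by exact_mod_cast Nat.one_le_iff_ne_zero.2 hd
  have hx0 : 0 < x := (Real.exp_pos 1).trans_le hx
  have hl : 1 ≤ Real.log x := (Real.le_log_iff_exp_le hx0).2 hx
  rw [div_le_iff₀ (by positivity)]
  rcases lt_or_ge (x / d) 1 with h | h
  · rw [divisorSummatory_of_lt_one h]; positivity
  · refine (divisorSummatory_le h).trans ?_
    have : Real.log (x / d) ≤ Real.log x := Real.log_le_log (by positivity)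
      (div_le_self hx0.le hd1)
    calc x / d * (1 + Real.log (x / d)) ≤ x / d * (2 * Real.log x) := by gcongr; linarith
      _ = _ := by ring

theorem tendsto_sum_mul_divisorSummatory {g : ℕ → ℝ} (h0 : g 0 = 0)
    (hg : Summable fun n => |g n| / n) :
    Tendsto (fun x : ℝ => (∑ n ∈ Finset.Ioc 0 ⌊x⌋₊, g n * divisorSummatory (x / n)) /
      (x * Real.log x)) atTop (nhds (∑' n, g n * (1 / n))) := by
  have hT := tendsto_tsum_of_dominated_convergence (𝓕 := atTop)
    (f := fun (x : ℝ) (n : ℕ) => g n * (divisorSummatory (x / n) / (x * Real.log x)))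
    (g := fun n => g n * (1 / n)) (bound := fun n => 2 * (|g n| / n)) (hg.mul_left 2) ?_ ?_
  · refine hT.congr' ?_
    filter_upwards [eventually_gt_atTop 0] with x hx
    -- The terms with n > x vanish, so the finite sum is already the whole series.
    rw [tsum_eq_sum (s := Finset.Ioc 0 ⌊x⌋₊), Finset.sum_div]
    · exact Finset.sum_congr rfl fun n _ => (mul_div_assoc _ _ _).symm
    · intro n hn
      rcases Nat.eq_zero_or_pos n with rfl | hn0
      · simp [h0]
      · have : ⌊x⌋₊ < n := by
          by_contra hc
          exact hn (Finset.mem_Ioc.2 ⟨hn0, not_lt.1 hc⟩)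
        rw [divisorSummatory_of_lt_one ((div_lt_one (by positivity)).2
          ((Nat.floor_lt hx.le).1 this))]
        simp
  · intro n
    rcases Nat.eq_zero_or_pos n with rfl | hn0
    · simp [h0]
    · exact (tendsto_divisorSummatory_div n hn0.ne').const_mul _
  · filter_upwards [eventually_ge_atTop (Real.exp 1)] with x hx n
    rcases Nat.eq_zero_or_pos n with rfl | hn0
    · simp [h0]
    · have hx0 : 0 < x := (Real.exp_pos 1).trans_le hx
      have hl : 1 ≤ Real.log x := (Real.le_log_iff_exp_le hx0).2 hx
      have := divisorSummatory_div_le hn0.ne' hx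
      have h2 := divisorSummatory_nonneg (x / n)
      rw [norm_mul, Real.norm_eq_abs, Real.norm_of_nonneg (by positivity)]
      calc _ ≤ |g n| * (2 / n) := by gcongr
        _ = _ := by ring

/-! ### Mean values of multiplicative functions equal to 2 at primes -/

/-- A multiplicative function that vanishes at the primes and is bounded by a power of the
number of divisors has an absolutely convergent Dirichlet series at `1`. -/
theorem summable_abs_div_of_isMultiplicative {g : ArithmeticFunction ℝ}
    (hg : g.IsMultiplicative) (hp : ∀ p : ℕ, p.Prime → g p = 0) (k : ℕ)
    (hb : ∀ n, |g n| ≤ (n.divisors.card : ℝ) ^ k) :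
    Summable fun n : ℕ => |g n| / n := by
  set f : ℕ → ℝ := fun n => |g n| / n with hf
  have hf0 : ∀ n, 0 ≤ f n := fun n => by positivity
  have hf1 : f 1 = 1 := by simp [hf, hg.map_one]
  have hmul : ∀ {m n : ℕ}, Nat.Coprime m n → f (m * n) = f m * f n := by
    intro m n h
    simp only [hf, hg.map_mul_of_coprime h, abs_mul, Nat.cast_mul]
    ring
  -- p^(e+2) has e + 3 divisors, and p^e ≥ 2^e leaves a factor 1/p² with a constant independent of
  -- p.
  set c : ℕ → ℝ := fun e => ((e : ℝ) + 3) ^ k * (1 / 2) ^ e with hc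
  have hcs : Summable c := by
    have h1 : Summable fun e : ℕ => (e : ℝ) ^ k * (1 / 2 : ℝ) ^ e :=
      summable_pow_mul_geometric_of_norm_lt_one k (by norm_num)
    have h2 := ((summable_nat_add_iff 3).2 h1).mul_left 8
    refine h2.congr fun e => ?_
    simp only [hc]; push_cast; ring
  have hc0 : ∀ e, 0 ≤ c e := fun e => by positivity
  have hle : ∀ {p : ℕ}, p.Prime → ∀ e, f (p ^ (e + 2)) ≤ c e * (1 / (p : ℝ) ^ 2) := by
    intro p hpp e
    have h2 : (2 : ℝ) ≤ p := by exact_mod_cast hpp.two_le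
    have hb' := hb (p ^ (e + 2))
    rw [Nat.divisors_prime_pow hpp, Finset.card_map, Finset.card_range] at hb'
    simp only [hf, hc]
    have e1 : ((e + 2 + 1 : ℕ) : ℝ) = e + 3 := by push_cast; ring
    rw [e1] at hb'
    push_cast
    rw [div_le_iff₀ (by positivity)]
    have : (1 : ℝ) ≤ (1 / 2) ^ e * (p : ℝ) ^ e := by
      rw [← mul_pow]; exact one_le_pow₀ (by linarith)
    calc _ ≤ ((e : ℝ) + 3) ^ k * 1 := by simpa using hb'
      _ ≤ ((e : ℝ) + 3) ^ k * ((1 / 2) ^ e * (p : ℝ) ^ e) := by gcongr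
      _ = _ := by rw [pow_add]; field_simp
  have hsum2 : ∀ {p : ℕ}, p.Prime → Summable fun e => f (p ^ (e + 2)) := fun hpp =>
    Summable.of_nonneg_of_le (fun _ => hf0 _) (hle hpp) (hcs.mul_right _)
  have hsum : ∀ {p : ℕ}, p.Prime → Summable fun e => f (p ^ e) := fun hpp =>
    (summable_nat_add_iff 2).1 (hsum2 hpp)
  set M : ℝ := ∑' e, c e with hM
  have hM0 : 0 ≤ M := tsum_nonneg hc0
  have hloc : ∀ {p : ℕ}, p.Prime → ∑' e, f (p ^ e) ≤ 1 + M * (1 / (p : ℝ) ^ 2) := by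
    intro p hpp
    rw [← (hsum hpp).sum_add_tsum_nat_add 2]
    have : ∑ i ∈ Finset.range 2, f (p ^ i) = 1 := by
      simp [Finset.sum_range_succ, hf1]
      simp [hf, hp p hpp]
    rw [this, hM, ← tsum_mul_right]
    gcongr
    · exact hsum2 hpp
    · exact hcs.mul_right _
    · exact hle hpp _
  have hz : Summable fun n : ℕ => 1 / (n : ℝ) ^ 2 :=
    Real.summable_one_div_nat_pow.2 one_lt_two
  -- Positive integers below N are N-smooth, so the partial sum is at most an Euler product with
  -- factors 1 + M/p² ≤ exp(M/p²).
  refine summable_of_sum_range_le (c := Real.exp (M * ∑' n : ℕ, 1 / (n : ℝ) ^ 2)) hf0 fun N => ?_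
  obtain ⟨hs1, hs2⟩ := EulerProduct.summable_and_hasSum_smoothNumbers_prod_primesBelow_tsum
    (f := f) hf1 hmul (fun hpp => (hsum hpp).norm) N
  have hprod : ∏ p ∈ N.primesBelow, ∑' e, f (p ^ e) ≤
      Real.exp (M * ∑' n : ℕ, 1 / (n : ℝ) ^ 2) := by
    calc _ ≤ ∏ p ∈ N.primesBelow, Real.exp (M * (1 / (p : ℝ) ^ 2)) := by
          refine Finset.prod_le_prod (fun p _ => tsum_nonneg fun _ => hf0 _) fun p h => ?_
          refine (hloc (Nat.prime_of_mem_primesBelow h)).trans ?_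
          rw [add_comm]
          exact Real.add_one_le_exp _
      _ = Real.exp (M * ∑ p ∈ N.primesBelow, 1 / (p : ℝ) ^ 2) := by
          rw [← Real.exp_sum, Finset.mul_sum]
      _ ≤ _ := by
          gcongr
          exact hz.sum_le_tsum _ fun _ _ => by positivity
  refine le_trans ?_ hprod
  rw [← hs2.tsum_eq, tsum_subtype (N.smoothNumbers : Set ℕ) f]
  have hs3 : Summable ((N.smoothNumbers : Set ℕ).indicator f) :=
    summable_subtype_iff_indicator.1 hs2.summable
  refine le_trans (Finset.sum_le_sum fun n hn => ?_)
    (hs3.sum_le_tsum (Finset.range N) fun _ _ => Set.indicator_nonneg (fun _ _ => hf0 _) _)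
  rcases Nat.eq_zero_or_pos n with rfl | hn0
  · simp [hf, Set.indicator]
  · rw [Set.indicator_of_mem]
    exact Nat.mem_smoothNumbers_of_lt hn0 (Finset.mem_range.1 hn)

open ArithmeticFunction ArithmeticFunction.zeta ArithmeticFunction.Moebius in
theorem abs_mul_moebius_le {F : ArithmeticFunction ℝ} {k : ℕ}
    (hb : ∀ n, |F n| ≤ (n.divisors.card : ℝ) ^ k) (n : ℕ) :
    |(F * ((μ : ArithmeticFunction ℤ) : ArithmeticFunction ℝ)) n| ≤
      (n.divisors.card : ℝ) ^ (k + 1) := by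
  rw [mul_apply]
  refine (Finset.abs_sum_le_sum_abs _ _).trans ?_
  calc _ ≤ ∑ _x ∈ n.divisorsAntidiagonal, (n.divisors.card : ℝ) ^ k := by
        refine Finset.sum_le_sum fun x hx => ?_
        obtain ⟨hx1, hx2⟩ := Nat.mem_divisorsAntidiagonal.1 hx
        rw [abs_mul]
        have h1 : |((μ : ArithmeticFunction ℤ) : ArithmeticFunction ℝ) x.2| ≤ 1 := by
          rw [intCoe_apply]
          exact_mod_cast abs_moebius_le_one
        have h2 : x.1.divisors.card ≤ n.divisors.card :=
          Finset.card_le_card (Nat.divisors_subset_of_dvd hx2 (Dvd.intro _ hx1))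
        calc _ ≤ |F x.1| * 1 := by gcongr
          _ ≤ _ := by
            rw [mul_one]
            refine (hb _).trans ?_
            gcongr
    _ = _ := by
        rw [Finset.sum_const, nsmul_eq_mul, ← Nat.map_div_right_divisors, Finset.card_map, pow_succ,
          mul_comm]

open ArithmeticFunction ArithmeticFunction.zeta ArithmeticFunction.Moebius in
theorem mul_moebius_apply_prime (F : ArithmeticFunction ℝ) {p : ℕ} (hp : p.Prime) :
    (F * ((μ : ArithmeticFunction ℤ) : ArithmeticFunction ℝ)) p = F p - F 1 := by
  rw [mul_apply, Nat.sum_divisorsAntidiagonal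
      (fun a b => F a * ((μ : ArithmeticFunction ℤ) : ArithmeticFunction ℝ) b),
    hp.sum_divisors]
  simp [hp.pos, moebius_apply_prime hp, intCoe_apply]
  ring

open ArithmeticFunction ArithmeticFunction.zeta ArithmeticFunction.Moebius in
theorem exists_tendsto_sum_div_of_isMultiplicative {F : ArithmeticFunction ℝ}
    (hF : F.IsMultiplicative) (hp : ∀ p : ℕ, p.Prime → F p = 2) (k : ℕ)
    (hb : ∀ n, |F n| ≤ (n.divisors.card : ℝ) ^ k) :
    ∃ C : ℝ, Tendsto (fun x : ℝ => (∑ n ∈ Finset.Ioc 0 ⌊x⌋₊, F n) / (x * Real.log x)) atTop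
      (nhds C) := by
  set m : ArithmeticFunction ℝ := ((μ : ArithmeticFunction ℤ) : ArithmeticFunction ℝ) with hm
  have hmm : m.IsMultiplicative := isMultiplicative_moebius.intCast
  have hmz : m * (ζ : ArithmeticFunction ℝ) = 1 := coe_moebius_mul_coe_zeta
  set g := F * m * m with hg
  have hgm : g.IsMultiplicative := (hF.mul hmm).mul hmm
  have hFg : F = g * ((ζ : ArithmeticFunction ℝ) * (ζ : ArithmeticFunction ℝ)) := by
    calc F = F * (m * ζ) * (m * ζ) := by rw [hmz, mul_one, mul_one]
      _ = _ := by rw [hg]; ring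
  -- Each convolution with μ lowers the value at p by 1, so the two of them cancel F(p) = 2.
  have hgp : ∀ p : ℕ, p.Prime → g p = 0 := by
    intro p hpp
    rw [hg, hm, mul_moebius_apply_prime _ hpp, mul_moebius_apply_prime _ hpp, ← hm,
      (hF.mul hmm).map_one, hF.map_one, hp p hpp]
    norm_num
  have hsum := summable_abs_div_of_isMultiplicative hgm hgp (k + 1 + 1)
    (abs_mul_moebius_le (abs_mul_moebius_le hb))
  refine ⟨_, (tendsto_sum_mul_divisorSummatory g.map_zero hsum).congr fun x => ?_⟩
  congr 1
  conv_rhs => rw [hFg]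
  rw [sum_Ioc_mul_eq_sum_sum]
  refine Finset.sum_congr rfl fun n _ => ?_
  rw [sum_Ioc_zeta_mul_zeta_eq_sum, divisorSummatory, Nat.floor_div_natCast]

theorem one_le_of_tendsto_sum_div {F : ℕ → ℝ} (hF : ∀ n, (n.divisors.card : ℝ) ≤ F n) {C : ℝ}
    (hC : Tendsto (fun x : ℝ => (∑ n ∈ Finset.Ioc 0 ⌊x⌋₊, F n) / (x * Real.log x)) atTop
      (nhds C)) : 1 ≤ C := by
  have h1 := tendsto_divisorSummatory_div 1 one_ne_zero
  simp only [Nat.cast_one, div_one] at h1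
  refine le_of_tendsto_of_tendsto h1 hC ?_
  filter_upwards [eventually_gt_atTop 1] with x hx
  have hl : 0 < Real.log x := Real.log_pos hx
  have hx0 : 0 < x := by linarith
  gcongr
  have := ArithmeticFunction.sum_Ioc_sigma0_eq_sum_div ⌊x⌋₊
  rw [divisorSummatory, ← Nat.cast_sum, ← this, Nat.cast_sum]
  refine Finset.sum_le_sum fun n _ => ?_
  rw [ArithmeticFunction.sigma_zero_apply]
  exact hF n

/-! ### Splitting abelian groups along coprime factors -/

section Coprime

theorem nsmul_eq_zero_of_card_dvd {A : Type*} [AddCommGroup A] {k : ℕ} (h : Nat.card A ∣ k)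
    (x : A) : k • x = 0 := by
  obtain ⟨c, rfl⟩ := h
  rw [mul_nsmul, card_nsmul_eq_zero', nsmul_zero]

theorem Nat.Coprime.eq_zero_of_nsmul_eq_zero {A : Type*} [AddCommGroup A] {m n : ℕ}
    (h : m.Coprime n) {x : A} (hm : m • x = 0) (hn : n • x = 0) : x = 0 := by
  have h1 := addOrderOf_dvd_of_nsmul_eq_zero hm
  have h2 := addOrderOf_dvd_of_nsmul_eq_zero hn
  have h3 := Nat.dvd_gcd h1 h2
  rw [h] at h3
  exact AddMonoid.addOrderOf_eq_one_iff.1 (Nat.dvd_one.1 h3)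

variable {G G' K K' : Type*} [AddCommGroup G] [AddCommGroup G'] [AddCommGroup K]
  [AddCommGroup K'] {m n : ℕ}

/-- The second coordinate of `e (x, 0)` is killed by both `m` and `n`, so `e` respects the first
factors. -/
theorem Nat.Coprime.nonempty_addEquiv_fst (h : m.Coprime n) (hG : ∀ x : G, m • x = 0)
    (hK : ∀ x : K, m • x = 0) (hG' : ∀ x : G', n • x = 0) (hK' : ∀ x : K', n • x = 0)
    (e : G × G' ≃+ K × K') : Nonempty (G ≃+ K) := by
  have h1 : ∀ x : G, ((e (x, 0)).1, 0) = e (x, 0) := by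
    intro x
    refine Prod.ext rfl (h.eq_zero_of_nsmul_eq_zero ?_ (hK' _)).symm
    rw [← Prod.smul_snd, ← map_nsmul, Prod.smul_mk, hG, smul_zero, Prod.mk_zero_zero, map_zero,
      Prod.snd_zero]
  have h2 : ∀ x : K, ((e.symm (x, 0)).1, 0) = e.symm (x, 0) := by
    intro x
    refine Prod.ext rfl (h.eq_zero_of_nsmul_eq_zero ?_ (hG' _)).symm
    rw [← Prod.smul_snd, ← map_nsmul, Prod.smul_mk, hK, smul_zero, Prod.mk_zero_zero, map_zero,
      Prod.snd_zero]
  exact ⟨{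
    toFun := fun x => (e (x, 0)).1
    invFun := fun x => (e.symm (x, 0)).1
    left_inv := fun x => by simp [h1]
    right_inv := fun x => by simp [h2]
    map_add' := fun x y => by rw [← Prod.fst_add, ← map_add]; simp }⟩

theorem Nat.Coprime.nonempty_addEquiv_of_prod (h : m.Coprime n)
    (hG : Nat.card G ∣ m) (hK : Nat.card K ∣ m) (hG' : Nat.card G' ∣ n) (hK' : Nat.card K' ∣ n)
    (e : G × G' ≃+ K × K') : Nonempty (G ≃+ K) ∧ Nonempty (G' ≃+ K') :=
  ⟨h.nonempty_addEquiv_fst (nsmul_eq_zero_of_card_dvd hG) (nsmul_eq_zero_of_card_dvd hK)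
    (nsmul_eq_zero_of_card_dvd hG') (nsmul_eq_zero_of_card_dvd hK') e,
  h.symm.nonempty_addEquiv_fst (nsmul_eq_zero_of_card_dvd hG') (nsmul_eq_zero_of_card_dvd hK')
    (nsmul_eq_zero_of_card_dvd hG) (nsmul_eq_zero_of_card_dvd hK)
    ((AddEquiv.prodComm.trans e).trans AddEquiv.prodComm)⟩

theorem Nat.Coprime.exists_mul_nsmul_eq (h : m.Coprime n) (A : Type*) [AddCommGroup A] :
    ∃ u v : ℤ, ∀ x : A, m • u • x + n • v • x = x := by
  refine ⟨m.gcdA n, m.gcdB n, fun x => ?_⟩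
  have hb := Nat.gcd_eq_gcd_ab m n
  rw [h] at hb
  rw [← natCast_zsmul, ← natCast_zsmul, smul_smul, smul_smul, ← add_smul, ← hb]
  simp

theorem Nat.Coprime.rank_prod_le [Finite G] [Finite G'] (h : m.Coprime n) {r : ℕ}
    (hG : Nat.card G = m) (hG' : Nat.card G' = n) (hr : AddGroup.rank G ≤ r)
    (hr' : AddGroup.rank G' ≤ r) : AddGroup.rank (G × G') ≤ r := by
  obtain ⟨φ, hφ⟩ := AddGroup.rank_le_iff_exists_surjective.1 hr
  obtain ⟨ψ, hψ⟩ := AddGroup.rank_le_iff_exists_surjective.1 hr'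
  refine AddGroup.rank_le_iff_exists_surjective.2 ⟨φ.prod ψ, ?_⟩
  rintro ⟨a, b⟩
  obtain ⟨x, rfl⟩ := hφ a
  obtain ⟨y, rfl⟩ := hψ b
  have h1 : ∀ z : G, m • z = 0 := nsmul_eq_zero_of_card_dvd hG.dvd
  have h2 : ∀ z : G', n • z = 0 := nsmul_eq_zero_of_card_dvd hG'.dvd
  obtain ⟨u, v, huv⟩ := h.exists_mul_nsmul_eq (G × G')
  -- Chinese remainder: n·v is 1 on `G` and 0 on `G'`, and m·u the reverse.
  refine ⟨n • v • x + m • u • y, ?_⟩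
  have := huv (φ x, ψ y)
  simp only [Prod.smul_mk, Prod.mk_add_mk, h1, h2, zero_add, add_zero, Prod.mk.injEq] at this
  have h3 : ψ (n • v • x) = 0 := by rw [map_nsmul, h2]
  have h4 : φ (m • u • y) = 0 := by rw [map_nsmul, h1]
  change (φ _, ψ _) = _
  rw [map_add, map_add, h3, h4, zero_add, add_zero, map_nsmul,
    map_zsmul, map_nsmul, map_zsmul, this.1, this.2]

/-- The elements of an abelian group killed by `m`. -/
def nsmulKer (G : Type*) [AddCommGroup G] (m : ℕ) : AddSubgroup G :=
  (nsmulAddMonoidHom (α := G) m).ker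

theorem mem_nsmulKer {x : G} : x ∈ nsmulKer G m ↔ m • x = 0 := Iff.rfl

/-- By Cauchy, a common prime would give an element of that order killed by both `m` and `n`. -/
theorem Nat.Coprime.card_nsmulKer [Finite G] (h : m.Coprime n) :
    (Nat.card (nsmulKer G m)).Coprime n := by
  refine Nat.coprime_of_dvd fun p hp h1 h2 => ?_
  have := Fact.mk hp
  obtain ⟨x, hx⟩ := exists_prime_addOrderOf_dvd_card' p h1
  have hn : n • x = 0 := addOrderOf_dvd_iff_nsmul_eq_zero.1 (hx.symm ▸ h2)
  have hm : m • x = 0 := Subtype.ext x.2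
  rw [h.eq_zero_of_nsmul_eq_zero hm hn, addOrderOf_zero] at hx
  exact hp.one_lt.ne hx

theorem Nat.Coprime.bijective_nsmulKer_coprod (h : m.Coprime n)
    (hG : ∀ x : G, (m * n) • x = 0) :
    Function.Bijective ((nsmulKer G m).subtype.coprod (nsmulKer G n).subtype) := by
  obtain ⟨u, v, huv⟩ := h.exists_mul_nsmul_eq G
  constructor
  · rw [injective_iff_map_eq_zero]
    rintro ⟨⟨a, ha⟩, ⟨b, hb⟩⟩ hab
    simp only [AddMonoidHom.coprod_apply, AddSubgroup.coe_subtype] at hab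
    obtain rfl : a = -b := eq_neg_of_add_eq_zero_left hab
    have hb0 : b = 0 := h.eq_zero_of_nsmul_eq_zero
      (by simpa using mem_nsmulKer.1 (neg_mem ha)) hb
    subst hb0
    ext <;> simp
  · intro x
    refine ⟨(⟨n • v • x, ?_⟩, ⟨m • u • x, ?_⟩), ?_⟩
    · rw [mem_nsmulKer, ← mul_nsmul', hG]
    · rw [mem_nsmulKer, ← mul_nsmul, hG]
    · simp only [AddMonoidHom.coprod_apply, AddSubgroup.coe_subtype]
      rw [add_comm, huv]

/-- An abelian group killed by a product of coprime integers is the direct sum of the kernels of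
the multiplications by the two factors. -/
noncomputable def Nat.Coprime.nsmulKerEquiv (h : m.Coprime n)
    (hG : ∀ x : G, (m * n) • x = 0) : nsmulKer G m × nsmulKer G n ≃+ G :=
  AddEquiv.ofBijective _ (h.bijective_nsmulKer_coprod hG)

theorem Nat.Coprime.nsmulKerEquiv_apply (h : m.Coprime n) (hG : ∀ x : G, (m * n) • x = 0)
    (x : nsmulKer G m × nsmulKer G n) : h.nsmulKerEquiv hG x = x.1 + x.2 := rfl

/-- The projection to the `m`-part is multiplication by the integer n·v, which preserves every
subgroup. -/
theorem Nat.Coprime.comap_nsmulKerEquiv (h : m.Coprime n) (hG : ∀ x : G, (m * n) • x = 0)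
    (H : AddSubgroup G) :
    H.comap (h.nsmulKerEquiv hG : nsmulKer G m × nsmulKer G n →+ G) =
      (H.addSubgroupOf (nsmulKer G m)).prod (H.addSubgroupOf (nsmulKer G n)) := by
  obtain ⟨u, v, huv⟩ := h.exists_mul_nsmul_eq G
  ext ⟨⟨a, ha⟩, ⟨b, hb⟩⟩
  simp only [AddSubgroup.mem_comap, AddMonoidHom.coe_coe, h.nsmulKerEquiv_apply,
    AddSubgroup.mem_prod, AddSubgroup.mem_addSubgroupOf]
  refine ⟨fun hab => ?_, fun hab => add_mem hab.1 hab.2⟩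
  rw [mem_nsmulKer] at ha hb
  have h1 : n • v • (a + b) = a := by
    have := huv a
    rw [smul_comm m u a, ha, smul_zero, zero_add] at this
    rw [smul_add, smul_add, this, smul_comm n v b, hb, smul_zero, add_zero]
  have hmem : a ∈ H := h1 ▸ nsmul_mem (zsmul_mem hab _) _
  exact ⟨hmem, by simpa using sub_mem hab hmem⟩

theorem Nat.Coprime.card_nsmulKer_eq [Finite G] (h : m.Coprime n) (hG : Nat.card G = m * n) :
    Nat.card (nsmulKer G m) = m ∧ Nat.card (nsmulKer G n) = n := by
  have hc : Nat.card (nsmulKer G m) * Nat.card (nsmulKer G n) = m * n := by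
    rw [← Nat.card_prod, ← hG]
    exact Nat.card_congr (h.nsmulKerEquiv (nsmul_eq_zero_of_card_dvd hG.dvd)).toEquiv
  have h1 : Nat.card (nsmulKer G m) ∣ m :=
    (h.card_nsmulKer (G := G)).dvd_of_dvd_mul_right (hc ▸ Dvd.intro _ rfl)
  have h2 : Nat.card (nsmulKer G n) ∣ n :=
    (h.symm.card_nsmulKer (G := G)).dvd_of_dvd_mul_left (hc ▸ Dvd.intro_left _ rfl)
  have hpos : 0 < m * n := hG ▸ Nat.card_pos
  have hm : 0 < m := Nat.pos_of_mul_pos_right hpos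
  have hn : 0 < n := Nat.pos_of_mul_pos_left hpos
  have h1' := Nat.le_of_dvd hm h1
  have h2' := Nat.le_of_dvd hn h2
  -- Two divisors of m and n with product mn cannot be proper.
  constructor <;> nlinarith

end Coprime

/-! ### Multiplicativity of the class count -/

namespace FinAbSubgroup

/-- The direct sum of two finite abelian groups with the direct sum of the chosen subgroups. -/
def prod (P Q : FinAbSubgroup) : FinAbSubgroup where
  carrier := P.carrier × Q.carrier
  sub := P.sub.prod Q.sub

/-- The direct sum of subgroup classes. -/
def classProd : FinAbSubgroupClass → FinAbSubgroupClass → FinAbSubgroupClass :=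
  Quotient.map₂ prod fun _ _ ⟨⟨e⟩, ⟨f⟩⟩ _ _ ⟨⟨e'⟩, ⟨f'⟩⟩ =>
    ⟨⟨AddEquiv.prodCongr e e'⟩, ⟨((AddSubgroup.prodEquiv _ _).trans
      (AddEquiv.prodCongr f f')).trans (AddSubgroup.prodEquiv _ _).symm⟩⟩

theorem exists_prod_equiv {m n : ℕ} (h : m.Coprime n) (P : FinAbSubgroup)
    (hP : Nat.card P.carrier = m * n) :
    ∃ Q R : FinAbSubgroup, AddGroup.rank Q.carrier ≤ AddGroup.rank P.carrier ∧
      Nat.card Q.carrier = m ∧ AddGroup.rank R.carrier ≤ AddGroup.rank P.carrier ∧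
      Nat.card R.carrier = n ∧
      Quotient.mk setoid (Q.prod R) = Quotient.mk setoid P := by
  obtain ⟨h1, h2⟩ := h.card_nsmulKer_eq hP
  have hann : ∀ x : P.carrier, (m * n) • x = 0 := nsmul_eq_zero_of_card_dvd hP.dvd
  refine ⟨⟨nsmulKer P.carrier m, P.sub.addSubgroupOf _⟩,
    ⟨nsmulKer P.carrier n, P.sub.addSubgroupOf _⟩, AddSubgroup.rank_le_rank _, h1,
    AddSubgroup.rank_le_rank _, h2, mk_eq_mk.2 ⟨⟨h.nsmulKerEquiv hann⟩, ?_⟩⟩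
  have hmap : ((P.sub.addSubgroupOf (nsmulKer P.carrier m)).prod
      (P.sub.addSubgroupOf (nsmulKer P.carrier n))).map
        (h.nsmulKerEquiv hann : nsmulKer P.carrier m × nsmulKer P.carrier n →+ P.carrier) =
      P.sub := by
    rw [← h.comap_nsmulKerEquiv hann]
    exact AddSubgroup.map_comap_eq_self_of_surjective (h.nsmulKerEquiv hann).surjective _
  exact ⟨((h.nsmulKerEquiv hann).addSubgroupMap _).trans (AddEquiv.addSubgroupCongr hmap)⟩

end FinAbSubgroup

open FinAbSubgroup

theorem ncard_subgroupClassesOfCard_mul (r : ℕ) {m n : ℕ} (h : m.Coprime n) :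
    (subgroupClassesOfCard r (m * n)).ncard =
      (subgroupClassesOfCard r m).ncard * (subgroupClassesOfCard r n).ncard := by
  have himg : subgroupClassesOfCard r (m * n) =
      (fun c : FinAbSubgroupClass × FinAbSubgroupClass => classProd c.1 c.2) ''
        (subgroupClassesOfCard r m ×ˢ subgroupClassesOfCard r n) := by
    ext c
    constructor
    · rintro ⟨P, hr, hc, rfl⟩
      obtain ⟨Q, R, hQ, hQ', hR, hR', he⟩ := exists_prod_equiv h P hc
      exact ⟨(Quotient.mk _ Q, Quotient.mk _ R), ⟨⟨Q, hQ.trans hr, hQ', rfl⟩,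
        ⟨R, hR.trans hr, hR', rfl⟩⟩, he⟩
    · rintro ⟨⟨_, _⟩, ⟨⟨Q, hQ, hQ', rfl⟩, ⟨R, hR, hR', rfl⟩⟩, rfl⟩
      exact ⟨Q.prod R, h.rank_prod_le hQ' hR' hQ hR, by
        rw [← hQ', ← hR']; exact Nat.card_prod _ _, rfl⟩
  rw [himg, Set.InjOn.ncard_image, Set.ncard_prod]
  rintro ⟨_, _⟩ ⟨⟨Q, -, hQ, rfl⟩, ⟨R, -, hR, rfl⟩⟩ ⟨_, _⟩
    ⟨⟨Q', -, hQ', rfl⟩, ⟨R', -, hR', rfl⟩⟩ heq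
  obtain ⟨⟨e⟩, ⟨f⟩⟩ := mk_eq_mk.1 (show Quotient.mk setoid (Q.prod R) =
    Quotient.mk setoid (Q'.prod R') from heq)
  obtain ⟨e1, e2⟩ := h.nonempty_addEquiv_of_prod hQ.dvd hQ'.dvd hR.dvd hR'.dvd e
  obtain ⟨f1, f2⟩ := h.nonempty_addEquiv_of_prod
    (Q.sub.card_addSubgroup_dvd_card.trans hQ.dvd) (Q'.sub.card_addSubgroup_dvd_card.trans hQ'.dvd)
    (R.sub.card_addSubgroup_dvd_card.trans hR.dvd) (R'.sub.card_addSubgroup_dvd_card.trans hR'.dvd)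
    (((AddSubgroup.prodEquiv _ _).symm.trans f).trans (AddSubgroup.prodEquiv _ _))
  exact Prod.ext (mk_eq_mk.2 ⟨e1, f1⟩) (mk_eq_mk.2 ⟨e2, f2⟩)

/-! ### Lower bound, values at primes and conclusion -/

theorem rank_zmod_le (n : ℕ) [NeZero n] {r : ℕ} (hr : 1 ≤ r) : AddGroup.rank (ZMod n) ≤ r := by
  refine (AddGroup.rank_le (S := {1}) ?_).trans hr
  rw [Finset.coe_singleton, ← AddSubgroup.zmultiples_eq_closure, eq_top_iff]
  intro x _
  obtain ⟨k, rfl⟩ := ZMod.intCast_surjective x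
  exact ⟨k, by simp⟩

/-- The subgroups dℤ/nℤ of the cyclic group, for d dividing n, have distinct orders n/d. -/
theorem card_divisors_le_ncard_subgroupClassesOfCard {r : ℕ} (hr : 1 ≤ r) (n : ℕ) :
    n.divisors.card ≤ (subgroupClassesOfCard r n).ncard := by
  rcases eq_or_ne n 0 with rfl | hn
  · simp
  have : NeZero n := ⟨hn⟩
  rw [← Set.ncard_coe_finset]
  refine Set.ncard_le_ncard_of_injOn
    (fun d => Quotient.mk setoid ⟨ZMod n, AddSubgroup.zmultiples (d : ZMod n)⟩)
    (fun d _ => ⟨_, rank_zmod_le n hr, Nat.card_zmod n, rfl⟩) ?_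
    (finite_subgroupClassesOfCard r n)
  intro d hd d' hd' h
  obtain ⟨-, ⟨f⟩⟩ := mk_eq_mk.1 h
  have hc : ∀ k : ℕ, k ∣ n → Nat.card (AddSubgroup.zmultiples (k : ZMod n)) = n / k := by
    intro k hk
    rw [Nat.card_zmultiples, ZMod.addOrderOf_coe _ hn, Nat.gcd_eq_right hk]
  have hd1 := Nat.dvd_of_mem_divisors hd
  have hd2 := Nat.dvd_of_mem_divisors hd'
  have := Nat.card_congr f.toEquiv
  simp only [hc d hd1, hc d' hd2] at this
  rw [← Nat.div_div_self hd1 hn, this, Nat.div_div_self hd2 hn]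

theorem ncard_subgroupClassesOfCard_prime {r : ℕ} (hr : 1 ≤ r) {p : ℕ} (hp : p.Prime) :
    (subgroupClassesOfCard r p).ncard = 2 := by
  have := Fact.mk hp
  refine le_antisymm ?_ ?_
  · have hsub : subgroupClassesOfCard r p ⊆ ({Quotient.mk setoid ⟨ZMod p, ⊥⟩,
        Quotient.mk setoid ⟨ZMod p, ⊤⟩} : Set (Quotient setoid)) := by
      rintro _ ⟨P, -, hc, rfl⟩
      have e : P.carrier ≃+ ZMod p := addEquivOfPrimeCardEq hc (Nat.card_zmod p)
      have : Fact (Nat.card P.carrier).Prime := ⟨hc ▸ hp⟩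
      rcases P.sub.eq_bot_or_eq_top_of_prime_card with h | h
      · refine Or.inl (mk_eq_mk.2 ⟨⟨e⟩, ?_⟩)
        rw [h]
        exact ⟨AddEquiv.ofUnique⟩
      · refine Or.inr (mk_eq_mk.2 ⟨⟨e⟩, ?_⟩)
        rw [h]
        exact ⟨(AddSubgroup.topEquiv.trans e).trans AddSubgroup.topEquiv.symm⟩
    refine (Set.ncard_le_ncard hsub ((Set.finite_singleton _).insert _)).trans ?_
    exact (Set.ncard_insert_le _ _).trans (Nat.succ_le_succ (Set.ncard_singleton _).le)
  · have := card_divisors_le_ncard_subgroupClassesOfCard hr p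
    rwa [Nat.Prime.divisors hp, Finset.card_pair hp.one_lt.ne] at this

/-- The number of subgroup classes of abelian groups of rank at most `r` and order `n`, as an
arithmetic function of `n`. -/
noncomputable def subgroupClassArith (r : ℕ) : ArithmeticFunction ℝ :=
  ⟨fun n => (subgroupClassesOfCard r n).ncard, by simp [subgroupClassesOfCard_zero]⟩

theorem subgroupClassArith_apply (r n : ℕ) :
    subgroupClassArith r n = (subgroupClassesOfCard r n).ncard := rfl

theorem abs_subgroupClassArith_le (r n : ℕ) :
    |subgroupClassArith r n| ≤ (n.divisors.card : ℝ) ^ (2 * r) := by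
  rcases eq_or_ne n 0 with rfl | hn
  · rw [ArithmeticFunction.map_zero, abs_zero]
    positivity
  · rw [subgroupClassArith_apply, Nat.abs_cast]
    exact_mod_cast ncard_subgroupClassesOfCard_le r hn

theorem isMultiplicative_subgroupClassArith {r : ℕ} (hr : 1 ≤ r) :
    (subgroupClassArith r).IsMultiplicative := by
  refine ⟨?_, fun {m n} h => ?_⟩
  -- At n = 1 the lower and upper divisor bounds are both 1.
  · have h1 := card_divisors_le_ncard_subgroupClassesOfCard hr 1
    have h2 := ncard_subgroupClassesOfCard_le r one_ne_zero
    simp only [Nat.divisors_one, Finset.card_singleton, one_pow] at h1 h2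
    rw [subgroupClassArith_apply, le_antisymm h2 h1, Nat.cast_one]
  · simp only [subgroupClassArith_apply, ncard_subgroupClassesOfCard_mul r h, Nat.cast_mul]

theorem corollary3 (r : ℕ) (hr : 1 ≤ r) :
    ∃ C : ℝ, 0 < C ∧
      IsEquivalent atTop (fun x : ℝ => (subgroupClassCount r x : ℝ))
        (fun x : ℝ => C * x * Real.log x) := by
  obtain ⟨C, hC⟩ := exists_tendsto_sum_div_of_isMultiplicative
    (isMultiplicative_subgroupClassArith hr)
    (fun p hp => by rw [subgroupClassArith_apply, ncard_subgroupClassesOfCard_prime hr hp]; rfl)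
    (2 * r) (abs_subgroupClassArith_le r)
  have hC1 : 1 ≤ C := one_le_of_tendsto_sum_div (fun n => by
    rw [subgroupClassArith_apply]
    exact_mod_cast card_divisors_le_ncard_subgroupClassesOfCard hr n) hC
  have hC0 : 0 < C := one_pos.trans_le hC1
  refine ⟨C, hC0, (isEquivalent_iff_tendsto_one ?_).2 ?_⟩
  · filter_upwards [eventually_gt_atTop 1] with x hx
    have := Real.log_pos hx
    positivity
  · have := hC.div_const C
    rw [div_self hC0.ne'] at this
    refine this.congr' ?_
    filter_upwards [eventually_ge_atTop 0] with x hx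
    simp only [Pi.div_apply, subgroupClassCount_eq_sum r hx, Nat.cast_sum,
      subgroupClassArith_apply]
    rw [div_div]
    congr 1
    ring
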